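/- Let $N\ge 0$ be an integer, let $\alpha_0,\alpha_1,\dots,\alpha_N$ be real numbers with $\alpha_0=0$, and let $\gamma_0>0$. Let $R(z)=\sum_{k=0}^{N}\alpha_k z^{-k}$ be the corresponding FIR filter and $T_{\mathrm{NTF}}(z)=1+R(z)$ the noise transfer function. Let $\|T\|_\infty:=\sup_{|z|>1}|T(z)|$ denote the discrete-time $H^\infty$ norm; for $T=T_{\mathrm{NTF}}$ it equals $\max_{\omega\in[0,2\pi]}|T(e^{\mathrm{j}\omega})|$. Let $$A=\begin{bmatrix}0&1&&0\\&\ddots&\ddots&\\&&\ddots&1\\0&&&0\end{bmatrix}\in\mathbb{R}^{N\times N},\qquad B=\begin{bmatrix}0\\\vdots\\0\\1\end{bmatrix}\in\mathbb{R}^{N\times 1},\qquad C(\alpha)=[\alpha_N,\alpha_{N-1},\dots,\alpha_1]\in\mathbb{R}^{1\times N},$$ which is the shift-register realization of $R$, $R(z)=C(\alpha)(zI-A)^{-1}B$. Then $\|T_{\mathrm{NTF}}\|_\infty<\gamma_0$ holds if and only if there exists a symmetric positive definite matrix $Z\in\mathbb{R}^{N\times N}$ such that the symmetric matrix $$\begin{bmatrix}A^\top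 ZA-Z&A^\top ZB&C(\alpha)^\top\\B^\top ZA&B^\top ZB-\gamma_0^2&1\\C(\alpha)&1&-1\end{bmatrix}$$ is negative definite. (For $N=0$ the blocks of size $N$ are empty.) -/

import Mathlib

open Matrix
open scoped ENNReal

noncomputable section

/-- The FIR filter `R(z) = ∑_{k=0}^{N} α_k z^{-k}`, for coefficients `α = [α_0, …, α_N]`. -/
def firFilter {N : ℕ} (α : Fin (N + 1) → ℝ) (z : ℂ) : ℂ :=
  ∑ k : Fin (N + 1), (α k : ℂ) * (z⁻¹) ^ (k : ℕ)

/-- The noise transfer function `1 + R(z)`. -/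
def noiseTransferFunction {N : ℕ} (α : Fin (N + 1) → ℝ) (z : ℂ) : ℂ :=
  1 + firFilter α z

/-- The discrete-time `H^∞` norm of a transfer function, i.e. its supremum norm on the exterior
`|z| > 1` of the closed unit disc (stable poles lie in `|z| < 1`).  It is extended-valued, so an
unbounded function has norm `∞`. -/
def hInfNorm (T : ℂ → ℂ) : ℝ≥0∞ :=
  ⨆ (z : ℂ) (_ : 1 < ‖z‖), ‖T z‖ₑ

/-- The shift-register state matrix: ones on the first superdiagonal, zeros elsewhere. -/
def stateA (N : ℕ) : Matrix (Fin N) (Fin N) ℝ :=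
  Matrix.of fun i j => if (j : ℕ) = (i : ℕ) + 1 then 1 else 0

/-- The input matrix `[0, …, 0, 1]ᵀ`. -/
def stateB (N : ℕ) : Matrix (Fin N) Unit ℝ :=
  Matrix.of fun i _ => if (i : ℕ) + 1 = N then 1 else 0

/-- The output matrix `C(α) = [α_N, α_{N-1}, …, α_1]`. -/
def stateC {N : ℕ} (α : Fin (N + 1) → ℝ) : Matrix Unit (Fin N) ℝ :=
  Matrix.of fun _ i => α (Fin.rev i).succ

/-- A real matrix is negative definite if its negative is positive definite
(in particular it is symmetric). -/
def NegDef {n : Type*} (M : Matrix n n ℝ) : Prop := (-M).PosDef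

/-- The `3 × 3` block matrix
```
  [ AᵀZA - Z    AᵀZB         C(α)ᵀ ]
  [ BᵀZA        BᵀZB - γ²    1     ]
  [ C(α)        1            -1    ]
``` -/
def boundedRealMatrix {N : ℕ} (α : Fin (N + 1) → ℝ) (γ : ℝ) (Z : Matrix (Fin N) (Fin N) ℝ) :
    Matrix ((Fin N ⊕ Unit) ⊕ Unit) ((Fin N ⊕ Unit) ⊕ Unit) ℝ :=
  fromBlocks
    (fromBlocks
      ((stateA N)ᵀ * Z * stateA N - Z) ((stateA N)ᵀ * Z * stateB N)
      ((stateB N)ᵀ * Z * stateA N)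
        ((stateB N)ᵀ * Z * stateB N - (γ ^ 2) • (1 : Matrix Unit Unit ℝ)))
    (fromRows (stateC α)ᵀ (1 : Matrix Unit Unit ℝ))
    (fromCols (stateC α) (1 : Matrix Unit Unit ℝ))
    (-1 : Matrix Unit Unit ℝ)

end

open Filter Topology

/-! This is the bounded real lemma in shift-register coordinates. A state `x` and an input `u`
together form a window of `N + 1` inputs, `A x + B u` is the window without its oldest entry, and `C
x + u` is the window's output `y`. Since `2 s y - s ^ 2` is at most `y ^ 2`, with equality at `s =
y`, the matrix inequality says that the form of `Z` is a storage function with strict dissipation: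
`Z(A x + B u) - Z(x) + y ^ 2 < γ ^ 2 u ^ 2` for nonzero `(x, u)`.

If such a `Z` exists, apply the inequality to the real and imaginary parts of the window `(1, z, …,
z ^ N)`. For `|z| > 1` the storage term is nonnegative, and what is left bounds `|T(z)| ^ 2` by `γ ^
2` minus a uniform margin.

Conversely, let `V_n(x)` be the largest cost `∑ (y ^ 2 + ε |v| ^ 2 - γ ^ 2 u ^ 2)` over `n` windows
`v` of a sequence beginning with `x`. Parseval and the norm bound keep it below `γ ^ 2 |x| ^ 2` for
small `ε` (`horizonCost_le`). Eliminating one variable at a time shows that `V_n` is quadratic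
(`exists_isGreatest_horizonCosts`). It increases with `n`, and its limit is the form of `Z`; the
Bellman inequality passes to the limit and is the dissipation inequality. -/

/-- The output of the FIR filter with coefficients `c` on the window `v` of inputs, the latest
input being the last entry of `v`. -/
noncomputable def windowOutput {N : ℕ} (c v : Fin (N + 1) → ℝ) : ℝ :=
  ∑ i, c (Fin.rev i) * v i

/-! ### Energy bound for the filter via Parseval -/

theorem sum_norm_coeff_mul_sq_le (p q : Polynomial ℂ) {g : ℝ}
    (hp : ∀ z : ℂ, ‖z‖ = 1 → ‖p.eval z‖ ≤ g) :
    ∑ i ∈ (p * q).support, ‖(p * q).coeff i‖ ^ 2 ≤ g ^ 2 * ∑ i ∈ q.support, ‖q.coeff i‖ ^ 2 := by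
  rw [Polynomial.sum_sq_norm_coeff_eq_circleAverage, Polynomial.sum_sq_norm_coeff_eq_circleAverage,
    ← smul_eq_mul (g ^ 2), ← Real.circleAverage_fun_smul]
  have hint : ∀ r : Polynomial ℂ, CircleIntegrable (fun z => ‖r.eval z‖ ^ 2) 0 1 := fun r =>
    ContinuousOn.circleIntegrable zero_le_one (by fun_prop)
  refine Real.circleAverage_mono (hint _) ?_ ?_
  · exact ContinuousOn.circleIntegrable zero_le_one (by fun_prop)
  · intro z hz
    have hz1 : ‖z‖ = 1 := by simpa using hz
    simp only [Polynomial.eval_mul, norm_mul, mul_pow, smul_eq_mul]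
    gcongr
    exact hp z hz1

theorem sum_norm_coeff_sq_le (p : Polynomial ℂ) (s : Finset ℕ) :
    ∑ i ∈ s, ‖p.coeff i‖ ^ 2 ≤ ∑ i ∈ p.support, ‖p.coeff i‖ ^ 2 := by
  calc ∑ i ∈ s, ‖p.coeff i‖ ^ 2 ≤ ∑ i ∈ s ∪ p.support, ‖p.coeff i‖ ^ 2 :=
        Finset.sum_le_sum_of_subset_of_nonneg Finset.subset_union_left (fun _ _ _ => by positivity)
    _ = ∑ i ∈ p.support, ‖p.coeff i‖ ^ 2 := by
        refine (Finset.sum_subset Finset.subset_union_right fun i _ hi => ?_).symm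
        simp [Polynomial.notMem_support_iff.mp hi]

/-- The outputs are the coefficients of index `N, …, N + L - 1` in the product of the filter
polynomial with the generating polynomial of the inputs; the other coefficients are discarded. -/
theorem sum_windowOutput_sq_le {N : ℕ} (c : Fin (N + 1) → ℝ) {g : ℝ}
    (hg : ∀ z : ℂ, ‖z‖ = 1 → ‖∑ k : Fin (N + 1), (c k : ℂ) * z ^ (k : ℕ)‖ ≤ g)
    (w : ℕ → ℝ) (L : ℕ) :
    ∑ t ∈ Finset.range L, windowOutput c (fun i => w (t + i)) ^ 2 ≤
      g ^ 2 * ∑ s ∈ Finset.range (L + N), w s ^ 2 := by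
  set p : Polynomial ℂ := ∑ k : Fin (N + 1), Polynomial.monomial (k : ℕ) (c k : ℂ) with hp
  set q : Polynomial ℂ := ∑ s ∈ Finset.range (L + N), Polynomial.monomial s (w s : ℂ) with hq
  have hqc : ∀ s, q.coeff s = if s < L + N then (w s : ℂ) else 0 := by
    intro s
    simp [hq, Polynomial.finsetSum_coeff, Polynomial.coeff_monomial]
  have hpq : ∀ t < L, (p * q).coeff (t + N) = (windowOutput c (fun i => w (t + i)) : ℝ) := by
    intro t ht
    rw [hp, Finset.sum_mul, Polynomial.finsetSum_coeff, windowOutput,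
      ← Equiv.sum_comp Fin.revPerm]
    push_cast
    refine Finset.sum_congr rfl fun i _ => ?_
    have hi := i.2
    have hr : t + N = (t + i) + (Fin.rev i : Fin (N+1)) := by simp [Fin.val_rev]; omega
    rw [Fin.revPerm_apply, hr, Polynomial.coeff_monomial_mul, hqc, if_pos (by omega)]
  have hqs : ∑ i ∈ q.support, ‖q.coeff i‖ ^ 2 = ∑ s ∈ Finset.range (L + N), w s ^ 2 := by
    have hsub : q.support ⊆ Finset.range (L + N) := by
      intro s hs
      by_contra h
      rw [Polynomial.mem_support_iff, hqc] at hs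
      simp at h hs
      omega
    rw [Finset.sum_subset hsub fun i _ hi => by simp [Polynomial.notMem_support_iff.mp hi]]
    refine Finset.sum_congr rfl fun s hs => ?_
    rw [hqc, if_pos (Finset.mem_range.mp hs)]
    simp
  calc ∑ t ∈ Finset.range L, windowOutput c (fun i => w (t + i)) ^ 2
      = ∑ t ∈ Finset.range L, ‖(p * q).coeff (t + N)‖ ^ 2 := by
        refine Finset.sum_congr rfl fun t ht => ?_
        rw [hpq t (Finset.mem_range.mp ht)]
        simp
    _ = ∑ t ∈ (Finset.range L).map (addRightEmbedding N), ‖(p * q).coeff t‖ ^ 2 := by simp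
    _ ≤ _ := sum_norm_coeff_sq_le _ _
    _ ≤ _ := sum_norm_coeff_mul_sq_le p q (g := g) (by
        intro z hz
        simpa [hp, Polynomial.eval_finsetSum] using hg z hz)
    _ = _ := by rw [hqs]

/-! ### Quadratic forms and elimination of a variable -/

/-- The quadratic form of a real square matrix. -/
def quadForm {n : Type*} [Fintype n] (S : Matrix n n ℝ) (x : n → ℝ) : ℝ := x ⬝ᵥ S *ᵥ x

theorem quadForm_eq_sum {n : Type*} [Fintype n] (S : Matrix n n ℝ) (x : n → ℝ) :
    quadForm S x = ∑ i, ∑ j, x i * S i j * x j := by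
  simp only [quadForm, dotProduct, mulVec, Finset.mul_sum, mul_assoc]

theorem quadForm_add {n : Type*} [Fintype n] (S T : Matrix n n ℝ) (x : n → ℝ) :
    quadForm (S + T) x = quadForm S x + quadForm T x := by
  simp only [quadForm, add_mulVec, dotProduct_add]

theorem quadForm_sub {n : Type*} [Fintype n] (S T : Matrix n n ℝ) (x : n → ℝ) :
    quadForm (S - T) x = quadForm S x - quadForm T x := by
  simp only [quadForm, sub_mulVec, dotProduct_sub]

theorem quadForm_smul {n : Type*} [Fintype n] (a : ℝ) (S : Matrix n n ℝ) (x : n → ℝ) :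
    quadForm (a • S) x = a * quadForm S x := by
  simp only [quadForm, smul_mulVec, dotProduct_smul, smul_eq_mul]

theorem quadForm_one {n : Type*} [Fintype n] [DecidableEq n] (x : n → ℝ) :
    quadForm (1 : Matrix n n ℝ) x = x ⬝ᵥ x := by
  simp only [quadForm, one_mulVec]

theorem quadForm_vecMulVec {n : Type*} [Fintype n] (a x : n → ℝ) :
    quadForm (vecMulVec a a) x = (a ⬝ᵥ x) ^ 2 := by
  simp [quadForm, vecMulVec_mulVec, sq, dotProduct_comm]

theorem isSymm_vecMulVec_self {n : Type*} (a : n → ℝ) : (vecMulVec a a).IsSymm := by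
  ext i j
  simp [vecMulVec_apply, mul_comm]

theorem quadForm_snoc {N : ℕ} (G : Matrix (Fin (N + 1)) (Fin (N + 1)) ℝ) (hG : G.IsSymm)
    (x : Fin N → ℝ) (u : ℝ) :
    quadForm G (Fin.snoc x u : Fin (N + 1) → ℝ) =
      quadForm (G.submatrix Fin.castSucc Fin.castSucc) x +
        2 * u * ((fun i : Fin N => G i.castSucc (Fin.last N)) ⬝ᵥ x) +
        G (Fin.last N) (Fin.last N) * u ^ 2 := by
  have h : ∀ i : Fin N, G (Fin.last N) i.castSucc = G i.castSucc (Fin.last N) :=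
    fun i => hG.apply _ _
  simp only [quadForm_eq_sum, Fin.sum_univ_castSucc, Fin.snoc_castSucc, Fin.snoc_last, h,
    submatrix_apply, Finset.sum_add_distrib, dotProduct, Finset.mul_sum]
  have : ∀ i : Fin N, 2 * u * (G i.castSucc (Fin.last N) * x i) =
    x i * G i.castSucc (Fin.last N) * u + u * G i.castSucc (Fin.last N) * x i := fun i => by ring
  simp only [this, Finset.sum_add_distrib]
  ring

/-- Maximizing a quadratic form over its last variable gives a quadratic form, provided that the
form is negative in that variable. -/
theorem exists_isGreatest_quadForm_snoc {N : ℕ} (G : Matrix (Fin (N + 1)) (Fin (N + 1)) ℝ)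
    (hG : G.IsSymm) (hneg : G (Fin.last N) (Fin.last N) < 0) :
    ∃ S : Matrix (Fin N) (Fin N) ℝ, S.IsSymm ∧ ∀ x : Fin N → ℝ,
      IsGreatest (Set.range fun u : ℝ => quadForm G (Fin.snoc x u : Fin (N + 1) → ℝ))
        (quadForm S x) := by
  set b : Fin N → ℝ := fun i => G i.castSucc (Fin.last N) with hb
  set a := G (Fin.last N) (Fin.last N) with ha
  have ha0 : a ≠ 0 := hneg.ne
  refine ⟨G.submatrix Fin.castSucc Fin.castSucc - a⁻¹ • vecMulVec b b,
    (hG.submatrix _).sub ((isSymm_vecMulVec_self b).smul _), fun x => ?_⟩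
  have key : ∀ u, quadForm G (Fin.snoc x u : Fin (N + 1) → ℝ) =
      quadForm (G.submatrix Fin.castSucc Fin.castSucc - a⁻¹ • vecMulVec b b) x +
        a * (u + a⁻¹ * (b ⬝ᵥ x)) ^ 2 := by
    intro u
    rw [quadForm_snoc G hG, quadForm_sub, quadForm_smul, quadForm_vecMulVec, ← hb, ← ha]
    field_simp
    ring
  constructor
  · exact ⟨-(a⁻¹ * (b ⬝ᵥ x)), by simp only [key]; ring⟩
  · rintro _ ⟨u, rfl⟩
    simp only [key]
    nlinarith [sq_nonneg (u + a⁻¹ * (b ⬝ᵥ x))]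

/-- The matrix on `N + 1` variables whose quadratic form is that of `S` on the last `N`. -/
def padFirst {N : ℕ} (S : Matrix (Fin N) (Fin N) ℝ) : Matrix (Fin (N + 1)) (Fin (N + 1)) ℝ :=
  Matrix.of (Fin.cons 0 fun i => Fin.cons 0 (S i))

theorem isSymm_padFirst {N : ℕ} {S : Matrix (Fin N) (Fin N) ℝ} (hS : S.IsSymm) :
    (padFirst S).IsSymm := by
  ext i j
  refine Fin.cases ?_ (fun i => ?_) i <;> refine Fin.cases ?_ (fun j => ?_) j <;>
    simp [padFirst, hS.apply]

theorem quadForm_padFirst {N : ℕ} (S : Matrix (Fin N) (Fin N) ℝ) (v : Fin (N + 1) → ℝ) :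
    quadForm (padFirst S) v = quadForm S (Fin.tail v) := by
  simp [quadForm_eq_sum, padFirst, Fin.sum_univ_succ, Fin.tail]

/-! ### Finite-horizon costs and their maxima -/

/-- The matrix of `stageCost`. -/
def stageMatrix {N : ℕ} (c : Fin (N + 1) → ℝ) (ε γ : ℝ) :
    Matrix (Fin (N + 1)) (Fin (N + 1)) ℝ :=
  vecMulVec (c ∘ Fin.rev) (c ∘ Fin.rev) + ε • (1 : Matrix (Fin (N + 1)) (Fin (N + 1)) ℝ) -
    γ ^ 2 • vecMulVec (Pi.single (Fin.last N) 1) (Pi.single (Fin.last N) 1)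

/-- The negated supply rate of the bounded real lemma on a window of inputs, with a margin `ε`. -/
noncomputable def stageCost {N : ℕ} (c : Fin (N + 1) → ℝ) (ε γ : ℝ) (v : Fin (N + 1) → ℝ) : ℝ :=
  windowOutput c v ^ 2 + ε * (v ⬝ᵥ v) - γ ^ 2 * v (Fin.last N) ^ 2

theorem isSymm_stageMatrix {N : ℕ} (c : Fin (N + 1) → ℝ) (ε γ : ℝ) :
    (stageMatrix c ε γ).IsSymm :=
  ((isSymm_vecMulVec_self _).add (isSymm_one.smul _)).sub ((isSymm_vecMulVec_self _).smul _)

theorem quadForm_stageMatrix {N : ℕ} (c : Fin (N + 1) → ℝ) (ε γ : ℝ) (v : Fin (N + 1) → ℝ) :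
    quadForm (stageMatrix c ε γ) v = stageCost c ε γ v := by
  rw [stageMatrix, quadForm_sub, quadForm_add, quadForm_smul, quadForm_smul, quadForm_vecMulVec,
    quadForm_vecMulVec, quadForm_one, single_one_dotProduct]
  rfl

/-- The total cost over the first `n` windows of an input sequence. -/
noncomputable def horizonCost {N : ℕ} (c : Fin (N + 1) → ℝ) (ε γ : ℝ) (n : ℕ) (w : ℕ → ℝ) : ℝ :=
  ∑ t ∈ Finset.range n, stageCost c ε γ (fun i : Fin (N + 1) => w (t + i))

theorem sum_window_sq_le {N : ℕ} (w : ℕ → ℝ) (L : ℕ) :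
    ∑ t ∈ Finset.range L, (fun i : Fin (N + 1) => w (t + i)) ⬝ᵥ (fun i => w (t + i)) ≤
      (N + 1) * ∑ s ∈ Finset.range (L + N), w s ^ 2 := by
  simp only [dotProduct]
  rw [Finset.sum_comm]
  have : ∀ i ∈ (Finset.univ : Finset (Fin (N + 1))),
      ∑ t ∈ Finset.range L, w (t + i) * w (t + i) ≤ ∑ s ∈ Finset.range (L + N), w s ^ 2 := by
    intro i _
    have hi := i.2
    calc ∑ t ∈ Finset.range L, w (t + i) * w (t + i)
        = ∑ s ∈ (Finset.range L).map (addRightEmbedding (i : ℕ)), w s ^ 2 := by simp [sq]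
      _ ≤ _ := by
        refine Finset.sum_le_sum_of_subset_of_nonneg ?_ (fun _ _ _ => by positivity)
        intro s hs
        simp only [Finset.mem_map, Finset.mem_range, addRightEmbedding_apply] at hs ⊢
        omega
  simpa using Finset.sum_le_sum this

/-- Each input lies in at most `N + 1` windows, hence the loss `ε * (N + 1)`. The first `N` inputs
are never the last entry of a window, so their `γ ^ 2` terms are added back. -/
theorem horizonCost_le {N : ℕ} (c : Fin (N + 1) → ℝ) {g ε γ : ℝ} (hε : 0 ≤ ε)
    (hg : ∀ z : ℂ, ‖z‖ = 1 → ‖∑ k : Fin (N + 1), (c k : ℂ) * z ^ (k : ℕ)‖ ≤ g)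
    (n : ℕ) (w : ℕ → ℝ) :
    horizonCost c ε γ n w ≤ γ ^ 2 * ∑ s ∈ Finset.range N, w s ^ 2 -
      (γ ^ 2 - g ^ 2 - ε * (N + 1)) * ∑ s ∈ Finset.range (n + N), w s ^ 2 := by
  have h1 := sum_windowOutput_sq_le c hg w n
  have h2 := mul_le_mul_of_nonneg_left (sum_window_sq_le (N := N) w n) hε
  have h3 : ∑ s ∈ Finset.range (n + N), w s ^ 2 =
      ∑ s ∈ Finset.range N, w s ^ 2 + ∑ t ∈ Finset.range n, w (t + N) ^ 2 := by
    rw [add_comm, Finset.sum_range_add]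
    simp only [add_comm]
  simp only [horizonCost, stageCost, Finset.sum_sub_distrib, Finset.sum_add_distrib,
    ← Finset.mul_sum, Fin.val_last]
  nlinarith

theorem horizonCost_succ {N : ℕ} (c : Fin (N + 1) → ℝ) (ε γ : ℝ) (n : ℕ) (w : ℕ → ℝ) :
    horizonCost c ε γ (n + 1) w =
      horizonCost c ε γ n (fun t => w (t + 1)) + stageCost c ε γ (fun i => w i) := by
  simp only [horizonCost, Finset.sum_range_succ', zero_add]
  congr 1
  refine Finset.sum_congr rfl fun t _ => ?_
  congr 1
  ext i
  congr 1
  omega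

/-- The costs over `n` windows of the input sequences that begin with `x`. -/
def horizonCosts {N : ℕ} (c : Fin (N + 1) → ℝ) (ε γ : ℝ) (n : ℕ) (x : Fin N → ℝ) : Set ℝ :=
  horizonCost c ε γ n '' {w | (fun i : Fin N => w i) = x}

theorem horizonCost_mem {N : ℕ} (c : Fin (N + 1) → ℝ) (ε γ : ℝ) (n : ℕ) (w : ℕ → ℝ) :
    horizonCost c ε γ n w ∈ horizonCosts c ε γ n (fun i : Fin N => w i) :=
  ⟨w, rfl, rfl⟩

theorem exists_horizonCost_succ_eq {N : ℕ} {c : Fin (N + 1) → ℝ} {ε γ : ℝ} {n : ℕ}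
    {v : Fin (N + 1) → ℝ} {r : ℝ} (hr : r ∈ horizonCosts c ε γ n (Fin.tail v)) :
    ∃ w : ℕ → ℝ, (∀ i : Fin (N + 1), w i = v i) ∧
      horizonCost c ε γ (n + 1) w = r + stageCost c ε γ v := by
  obtain ⟨w, hw, rfl⟩ := hr
  set w' : ℕ → ℝ := fun t => Nat.casesOn t (v 0) w with hw'
  have hv : ∀ i : Fin (N + 1), w' i = v i :=
    Fin.cases rfl fun i => congrFun hw i
  refine ⟨w', hv, ?_⟩
  rw [horizonCost_succ, funext hv]

/-- One half of the Bellman recursion, by prepending `v 0` to a sequence; the next lemma is the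
other half. -/
theorem mem_horizonCosts_succ {N : ℕ} {c : Fin (N + 1) → ℝ} {ε γ : ℝ} {n : ℕ}
    {v : Fin (N + 1) → ℝ} {r : ℝ} (hr : r ∈ horizonCosts c ε γ n (Fin.tail v)) :
    r + stageCost c ε γ v ∈ horizonCosts c ε γ (n + 1) (Fin.init v) := by
  obtain ⟨w, hw, h⟩ := exists_horizonCost_succ_eq hr
  exact ⟨w, funext fun i => hw i.castSucc, h⟩

theorem exists_of_mem_horizonCosts_succ {N : ℕ} {c : Fin (N + 1) → ℝ} {ε γ : ℝ} {n : ℕ}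
    {x : Fin N → ℝ} {r : ℝ} (hr : r ∈ horizonCosts c ε γ (n + 1) x) :
    ∃ u : ℝ, ∃ r' ∈ horizonCosts c ε γ n (Fin.tail (Fin.snoc x u : Fin (N + 1) → ℝ)),
      r = r' + stageCost c ε γ (Fin.snoc x u) := by
  obtain ⟨w, rfl, rfl⟩ := hr
  have hv : (Fin.snoc (fun i : Fin N => w i) (w N) : Fin (N + 1) → ℝ) =
      fun i : Fin (N + 1) => w i := by
    ext i
    refine Fin.lastCases ?_ (fun i => ?_) i <;> simp
  refine ⟨w N, horizonCost c ε γ n (fun t => w (t + 1)), ?_, ?_⟩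
  · rw [hv]
    exact horizonCost_mem c ε γ n (fun t => w (t + 1))
  · rw [horizonCost_succ, hv]

theorem exists_isGreatest_horizonCosts {N : ℕ} (c : Fin (N + 1) → ℝ) {g ε γ : ℝ} (hε : 0 ≤ ε)
    (hg : ∀ z : ℂ, ‖z‖ = 1 → ‖∑ k : Fin (N + 1), (c k : ℂ) * z ^ (k : ℕ)‖ ≤ g)
    (hlt : 0 < γ ^ 2 - g ^ 2 - ε * (N + 1)) (n : ℕ) :
    ∃ S : Matrix (Fin N) (Fin N) ℝ, S.IsSymm ∧
      ∀ x, IsGreatest (horizonCosts c ε γ n x) (quadForm S x) := by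
  induction n with
  | zero =>
    refine ⟨0, isSymm_zero, fun x => ⟨?_, ?_⟩⟩
    · refine ⟨fun t => if h : t < N then x ⟨t, h⟩ else 0, ?_, ?_⟩
      · ext i
        simp
      · simp [horizonCost, quadForm]
    · rintro _ ⟨w, -, rfl⟩
      simp [horizonCost, quadForm]
  | succ n ih =>
    obtain ⟨S, hS, hmax⟩ := ih
    set G := padFirst S + stageMatrix c ε γ with hG
    have hGs : G.IsSymm := (isSymm_padFirst hS).add (isSymm_stageMatrix c ε γ)
    have hq : ∀ v, quadForm G v = quadForm S (Fin.tail v) + stageCost c ε γ v := fun v => by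
      rw [hG, quadForm_add, quadForm_padFirst, quadForm_stageMatrix]
    -- The corner entry is the cost of an actual sequence beginning with `N` zeros and a one, which
    -- the energy bound makes negative.
    have hneg : G (Fin.last N) (Fin.last N) < 0 := by
      have h1 : G (Fin.last N) (Fin.last N) =
          quadForm G (Fin.snoc (0 : Fin N → ℝ) 1 : Fin (N + 1) → ℝ) := by
        rw [quadForm_snoc G hGs]
        simp [quadForm]
      obtain ⟨w, hw, hwr⟩ := exists_horizonCost_succ_eq
        (hmax (Fin.tail (Fin.snoc (0 : Fin N → ℝ) 1 : Fin (N + 1) → ℝ))).1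
      have h0 : ∑ s ∈ Finset.range N, w s ^ 2 = 0 := by
        refine Finset.sum_eq_zero fun s hs => ?_
        have := hw (Fin.castSucc ⟨s, Finset.mem_range.mp hs⟩)
        rw [Fin.snoc_castSucc] at this
        simpa using this
      have hN : w N = 1 := by simpa using hw (Fin.last N)
      have hpos : 1 ≤ ∑ s ∈ Finset.range (n + 1 + N), w s ^ 2 := by
        have := Finset.single_le_sum (f := fun s => w s ^ 2) (fun s _ => sq_nonneg (w s))
          (Finset.mem_range.mpr (show N < n + 1 + N by omega))
        simpa [hN] using this
      have hle := horizonCost_le c (γ := γ) hε hg (n + 1) w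
      rw [h1, hq, ← hwr]
      rw [h0] at hle
      nlinarith
    obtain ⟨T, hT, hTmax⟩ := exists_isGreatest_quadForm_snoc G hGs hneg
    refine ⟨T, hT, fun x => ⟨?_, ?_⟩⟩
    · obtain ⟨u, hu⟩ := (hTmax x).1
      rw [← hu]
      simp only [hq]
      simpa using mem_horizonCosts_succ (hmax (Fin.tail (Fin.snoc x u : Fin (N + 1) → ℝ))).1
    · intro r hr
      obtain ⟨u, r', hr', rfl⟩ := exists_of_mem_horizonCosts_succ hr
      have := (hTmax x).2 ⟨u, rfl⟩
      simp only [hq] at this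
      linarith [(hmax _).2 hr']

/-! ### The infinite-horizon limit -/

theorem quadForm_single_add_single {n : Type*} [Fintype n] [DecidableEq n] {S : Matrix n n ℝ}
    (hS : S.IsSymm) (i j : n) :
    quadForm S (Pi.single i 1 + Pi.single j 1) =
      quadForm S (Pi.single i 1) + quadForm S (Pi.single j 1) + 2 * S i j := by
  have := hS.apply i j
  simp [quadForm, mulVec_add, this]
  ring

/-- By polarization, pointwise convergence of the forms forces convergence of the matrix entries. -/
theorem exists_tendsto_quadForm {n : Type*} [Fintype n] [DecidableEq n] (S : ℕ → Matrix n n ℝ)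
    (hS : ∀ k, (S k).IsSymm)
    (hlim : ∀ x, ∃ l, Tendsto (fun k => quadForm (S k) x) atTop (𝓝 l)) :
    ∃ T : Matrix n n ℝ, T.IsSymm ∧
      ∀ x, Tendsto (fun k => quadForm (S k) x) atTop (𝓝 (quadForm T x)) := by
  choose l hl using hlim
  have hent : ∀ i j, Tendsto (fun k => S k i j) atTop
      (𝓝 ((l (Pi.single i 1 + Pi.single j 1) - l (Pi.single i 1) - l (Pi.single j 1)) / 2)) := by
    intro i j
    refine Tendsto.congr (fun k => ?_) ((((hl (Pi.single i 1 + Pi.single j 1)).sub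
      (hl (Pi.single i 1))).sub (hl (Pi.single j 1))).div_const 2)
    rw [quadForm_single_add_single (hS k)]
    ring
  refine ⟨Matrix.of fun i j =>
    (l (Pi.single i 1 + Pi.single j 1) - l (Pi.single i 1) - l (Pi.single j 1)) / 2, ?_, ?_⟩
  · ext i j
    simp only [transpose_apply, of_apply]
    rw [add_comm (Pi.single j 1 : n → ℝ)]
    ring
  · intro x
    simp only [quadForm_eq_sum]
    exact tendsto_finsetSum _ fun i _ => tendsto_finsetSum _ fun j _ =>
      ((hent i j).const_mul (x i)).mul_const (x j)

/-- A quadratic storage function for the dissipation inequality with margin `ε`. -/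
theorem exists_quadForm_dissipation {N : ℕ} (c : Fin (N + 1) → ℝ) {g ε γ : ℝ} (hε : 0 < ε)
    (hg : ∀ z : ℂ, ‖z‖ = 1 → ‖∑ k : Fin (N + 1), (c k : ℂ) * z ^ (k : ℕ)‖ ≤ g)
    (hlt : 0 < γ ^ 2 - g ^ 2 - ε * (N + 1)) :
    ∃ Z : Matrix (Fin N) (Fin N) ℝ, Z.IsSymm ∧ (∀ x, x ≠ 0 → 0 < quadForm Z x) ∧
      ∀ v : Fin (N + 1) → ℝ,
        quadForm Z (Fin.tail v) + stageCost c ε γ v ≤ quadForm Z (Fin.init v) := by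
  choose S hS hmax using exists_isGreatest_horizonCosts c hε.le hg hlt
  have hdiss : ∀ n (v : Fin (N + 1) → ℝ),
      quadForm (S n) (Fin.tail v) + stageCost c ε γ v ≤ quadForm (S (n + 1)) (Fin.init v) :=
    fun n v => (hmax (n + 1) _).2 (mem_horizonCosts_succ (hmax n _).1)
  have hzero : ∀ x, quadForm (S 0) x = 0 := by
    intro x
    obtain ⟨w, -, h⟩ := (hmax 0 x).1
    simpa [horizonCost] using h.symm
  have hfree : ∀ x : Fin N → ℝ,
      ε * (x ⬝ᵥ x) ≤ stageCost c ε γ (Fin.snoc x 0 : Fin (N + 1) → ℝ) := by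
    intro x
    have : (Fin.snoc x 0 : Fin (N + 1) → ℝ) ⬝ᵥ (Fin.snoc x 0 : Fin (N + 1) → ℝ) = x ⬝ᵥ x := by
      simp [dotProduct, Fin.sum_univ_castSucc]
    rw [stageCost, this, Fin.snoc_last]
    nlinarith [sq_nonneg (windowOutput c (Fin.snoc x 0 : Fin (N + 1) → ℝ))]
  have hself : ∀ x : Fin N → ℝ, 0 ≤ x ⬝ᵥ x := fun x =>
    Finset.sum_nonneg fun i _ => mul_self_nonneg (x i)
  -- Value iteration started at zero is monotone: the zero input gives nonnegative cost at the first
  -- step, and the recursion preserves the order.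
  have hstep : ∀ n x, quadForm (S n) x ≤ quadForm (S (n + 1)) x := by
    intro n
    induction n with
    | zero =>
      intro x
      have := hdiss 0 (Fin.snoc x 0)
      rw [Fin.init_snoc, hzero] at this
      rw [hzero]
      nlinarith [hfree x, hself x]
    | succ n ih =>
      intro x
      obtain ⟨u, r, hr, h⟩ := exists_of_mem_horizonCosts_succ (hmax (n + 1) x).1
      have h1 := hdiss (n + 1) (Fin.snoc x u)
      rw [Fin.init_snoc] at h1
      linarith [(hmax n _).2 hr, ih (Fin.tail (Fin.snoc x u : Fin (N + 1) → ℝ))]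
  have hmono : ∀ x, Monotone fun n => quadForm (S n) x := fun x =>
    monotone_nat_of_le_succ fun n => hstep n x
  have hbdd : ∀ x, BddAbove (Set.range fun n => quadForm (S n) x) := by
    intro x
    refine ⟨γ ^ 2 * (x ⬝ᵥ x), ?_⟩
    rintro _ ⟨n, rfl⟩
    obtain ⟨w, rfl, h⟩ := (hmax n x).1
    have h1 := horizonCost_le c (γ := γ) hε.le hg n w
    have h2 : 0 ≤ ∑ s ∈ Finset.range (n + N), w s ^ 2 := by positivity
    simp only [dotProduct, ← sq]
    rw [← h, ← Finset.sum_range fun i => w i ^ 2]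
    nlinarith
  obtain ⟨Z, hZ, hlim⟩ := exists_tendsto_quadForm S hS fun x =>
    ⟨_, tendsto_atTop_ciSup (hmono x) (hbdd x)⟩
  have hZdiss : ∀ v : Fin (N + 1) → ℝ,
      quadForm Z (Fin.tail v) + stageCost c ε γ v ≤ quadForm Z (Fin.init v) := fun v =>
    le_of_tendsto_of_tendsto' ((hlim _).add_const _) ((tendsto_add_atTop_iff_nat 1).mpr (hlim _))
      fun n => hdiss n v
  have hnonneg : ∀ x, 0 ≤ quadForm Z x := fun x => by
    have := (hmono x).ge_of_tendsto (hlim x) 0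
    simpa only [hzero] using this
  refine ⟨Z, hZ, fun x hx => ?_, hZdiss⟩
  -- With zero input the stage cost is at least `ε |x| ^ 2`, so the margin makes `Z` strictly
  -- positive.
  have h1 := hZdiss (Fin.snoc x 0)
  rw [Fin.init_snoc] at h1
  have h2 : 0 < x ⬝ᵥ x := lt_of_le_of_ne (hself x) fun h =>
    hx (dotProduct_self_eq_zero.mp h.symm)
  nlinarith [hnonneg (Fin.tail (Fin.snoc x 0 : Fin (N + 1) → ℝ)), hfree x]

/-! ### The block matrix in terms of windows -/

/-- The coefficients of `1 + R(z)`, when the constant coefficient of `R` is zero. -/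
def ntfCoeff {N : ℕ} (α : Fin (N + 1) → ℝ) : Fin (N + 1) → ℝ :=
  Fin.cons 1 fun i => α i.succ

theorem noiseTransferFunction_eq {N : ℕ} {α : Fin (N + 1) → ℝ} (hα : α 0 = 0) (z : ℂ) :
    noiseTransferFunction α z = ∑ k : Fin (N + 1), (ntfCoeff α k : ℂ) * z⁻¹ ^ (k : ℕ) := by
  simp [noiseTransferFunction, firFilter, ntfCoeff, Fin.sum_univ_succ, hα]

theorem stateA_mulVec_add {N : ℕ} (x : Fin N → ℝ) (u : ℝ) :
    stateA N *ᵥ x + stateB N *ᵥ (fun _ => u) = Fin.tail (Fin.snoc x u : Fin (N + 1) → ℝ) := by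
  ext i
  simp only [Pi.add_apply, mulVec, dotProduct, stateA, stateB, of_apply, Fin.tail, ite_mul,
    one_mul, zero_mul, Finset.univ_unique, Finset.sum_singleton]
  by_cases h : (i : ℕ) + 1 < N
  · have h1 : i.succ = Fin.castSucc ⟨i + 1, h⟩ := rfl
    rw [h1, Fin.snoc_castSucc, if_neg h.ne, Finset.sum_eq_single ⟨i + 1, h⟩]
    · simp
    · intro j _ hj
      exact if_neg fun h2 => hj (Fin.ext h2)
    · simp
  · have h2 : (i : ℕ) + 1 = N := by omega
    have h1 : i.succ = Fin.last N := Fin.ext h2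
    rw [h1, Fin.snoc_last, if_pos h2, Finset.sum_eq_zero, zero_add]
    intro j _
    exact if_neg (by omega)

theorem stateC_mulVec_add {N : ℕ} (α : Fin (N + 1) → ℝ) (x : Fin N → ℝ) (u : ℝ) (j : Unit) :
    (stateC α *ᵥ x) j + u = windowOutput (ntfCoeff α) (Fin.snoc x u) := by
  simp [windowOutput, ntfCoeff, Fin.sum_univ_castSucc, stateC, mulVec, dotProduct,
    Fin.rev_castSucc]

theorem quadForm_fromBlocks {m n : Type*} [Fintype m] [Fintype n] (P : Matrix m m ℝ)
    (Q : Matrix m n ℝ) (R : Matrix n m ℝ) (T : Matrix n n ℝ) (x : m → ℝ) (y : n → ℝ) :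
    quadForm (fromBlocks P Q R T) (Sum.elim x y) =
      quadForm P x + x ⬝ᵥ Q *ᵥ y + (y ⬝ᵥ R *ᵥ x + quadForm T y) := by
  simp only [quadForm, fromBlocks_mulVec, sumElim_dotProduct_sumElim, dotProduct_add,
    Sum.elim_comp_inl, Sum.elim_comp_inr]

theorem dotProduct_transpose_mul_mul_mulVec {l m n : Type*} [Fintype l] [Fintype m] [Fintype n]
    (A : Matrix l m ℝ) (Z : Matrix l l ℝ) (B : Matrix l n ℝ) (x : m → ℝ) (y : n → ℝ) :
    x ⬝ᵥ (Aᵀ * Z * B) *ᵥ y = (A *ᵥ x) ⬝ᵥ Z *ᵥ (B *ᵥ y) := by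
  rw [← mulVec_mulVec, ← mulVec_mulVec, dotProduct_transpose_mulVec, dotProduct_comm]

theorem quadForm_boundedRealMatrix {N : ℕ} (α : Fin (N + 1) → ℝ) (γ : ℝ)
    (Z : Matrix (Fin N) (Fin N) ℝ) (x : Fin N → ℝ) (u s : ℝ) :
    quadForm (boundedRealMatrix α γ Z) (Sum.elim (Sum.elim x fun _ => u) fun _ => s) =
      quadForm Z (Fin.tail (Fin.snoc x u : Fin (N + 1) → ℝ)) - quadForm Z x - γ ^ 2 * u ^ 2 +
        2 * s * windowOutput (ntfCoeff α) (Fin.snoc x u) - s ^ 2 := by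
  rw [← stateA_mulVec_add, ← stateC_mulVec_add α x u ()]
  have hC : x ⬝ᵥ (stateC α)ᵀ *ᵥ (fun _ => s) = s * (stateC α *ᵥ x) () := by
    rw [dotProduct_transpose_mulVec]
    simp [dotProduct]
  have hC' : (fun _ : Unit => s) ⬝ᵥ stateC α *ᵥ x = s * (stateC α *ᵥ x) () := by
    simp [dotProduct]
  have hscalar : ∀ a b : ℝ, (fun _ : Unit => a) ⬝ᵥ (fun _ => b) = a * b := by
    simp [dotProduct]
  rw [boundedRealMatrix, quadForm_fromBlocks, quadForm_fromBlocks, quadForm_sub, quadForm_sub,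
    quadForm_smul, quadForm_one, fromRows_mulVec, fromCols_mulVec_sumElim,
    sumElim_dotProduct_sumElim, dotProduct_add, one_mulVec, one_mulVec, hC, hC']
  simp only [quadForm, neg_mulVec, one_mulVec, dotProduct_neg, hscalar,
    dotProduct_transpose_mul_mul_mulVec, mulVec_add, add_dotProduct, dotProduct_add]
  ring

theorem isSymm_boundedRealMatrix {N : ℕ} (α : Fin (N + 1) → ℝ) (γ : ℝ)
    {Z : Matrix (Fin N) (Fin N) ℝ} (hZ : Z.IsSymm) : (boundedRealMatrix α γ Z).IsSymm := by
  have hZ' : Zᵀ = Z := hZ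
  refine IsSymm.fromBlocks (IsSymm.fromBlocks ?_ ?_ ?_) ?_ ?_ <;>
    simp [IsSymm, transpose_mul, transpose_fromRows, hZ', Matrix.mul_assoc]

/-! ### From the matrix inequality to the norm bound -/

/-- Compactness of the unit sphere gives a uniform margin, which keeps the inequality strict after
the supremum over `z`. -/
theorem exists_mul_norm_sq_le_quadForm {n : Type*} [Fintype n] {M : Matrix n n ℝ}
    (hM : M.PosDef) : ∃ ε > 0, ∀ x, ε * ‖x‖ ^ 2 ≤ quadForm M x := by
  rcases isEmpty_or_nonempty n with hn | hn
  · exact ⟨1, one_pos, fun x => by simp [Subsingleton.elim x 0, quadForm]⟩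
  have hcont : Continuous (quadForm M) := by
    simp only [funext (quadForm_eq_sum M)]
    fun_prop
  obtain ⟨y, hy, hmin⟩ := (isCompact_sphere (0 : n → ℝ) 1).exists_isMinOn
    (NormedSpace.sphere_nonempty.mpr zero_le_one) hcont.continuousOn
  have hy0 : y ≠ 0 := by
    rintro rfl
    simp at hy
  refine ⟨quadForm M y, by simpa [quadForm] using hM.dotProduct_mulVec_pos hy0, fun x => ?_⟩
  rcases eq_or_ne x 0 with rfl | hx
  · simp [quadForm]
  have hx' : ‖x‖ ≠ 0 := norm_ne_zero_iff.mpr hx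
  have h1 : quadForm M y ≤ quadForm M (‖x‖⁻¹ • x) :=
    hmin (by simp [norm_smul, hx'])
  have h2 : quadForm M (‖x‖⁻¹ • x) = quadForm M x / ‖x‖ ^ 2 := by
    simp only [quadForm, mulVec_smul, smul_dotProduct, dotProduct_smul, smul_eq_mul]
    field_simp
  rw [h2, le_div_iff₀ (by positivity)] at h1
  exact h1

/-- The sum is the real part of `x̄ᵀ S x`, which scales by `|z| ^ 2`. -/
theorem quadForm_re_add_quadForm_im_mul {n : Type*} [Fintype n] (S : Matrix n n ℝ) (z : ℂ)
    (x : n → ℂ) :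
    quadForm S (fun i => (z * x i).re) + quadForm S (fun i => (z * x i).im) =
      ‖z‖ ^ 2 * (quadForm S (fun i => (x i).re) + quadForm S (fun i => (x i).im)) := by
  simp only [quadForm_eq_sum, ← Finset.sum_add_distrib, Finset.mul_sum, Complex.sq_norm,
    Complex.normSq_apply, Complex.mul_re, Complex.mul_im]
  refine Finset.sum_congr rfl fun i _ => Finset.sum_congr rfl fun j _ => ?_
  ring

theorem sum_ntfCoeff_rev_mul_pow {N : ℕ} {α : Fin (N + 1) → ℝ} (hα : α 0 = 0) {z : ℂ}
    (hz : z ≠ 0) :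
    ∑ i : Fin (N + 1), (ntfCoeff α (Fin.rev i) : ℂ) * z ^ (i : ℕ) =
      z ^ N * noiseTransferFunction α z := by
  rw [noiseTransferFunction_eq hα, Finset.mul_sum, ← Equiv.sum_comp Fin.revPerm]
  refine Finset.sum_congr rfl fun i _ => ?_
  have h : z ^ N = z ^ (Fin.rev i : ℕ) * z ^ (i : ℕ) := by
    rw [← pow_add]
    congr 1
    simp [Fin.val_rev]
    omega
  rw [Fin.revPerm_apply, Fin.rev_rev, h, inv_pow]
  field_simp

theorem norm_noiseTransferFunction_sq_le {N : ℕ} {α : Fin (N + 1) → ℝ} (hα : α 0 = 0) {γ ε : ℝ}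
    {Z : Matrix (Fin N) (Fin N) ℝ} (hZ : Z.PosDef) (hε : 0 < ε)
    (hM : ∀ x, ε * ‖x‖ ^ 2 ≤ quadForm (-boundedRealMatrix α γ Z) x) {z : ℂ} (hz : 1 < ‖z‖) :
    ‖noiseTransferFunction α z‖ ^ 2 ≤ γ ^ 2 - ε := by
  have hz0 : z ≠ 0 := norm_pos_iff.mp (one_pos.trans hz)
  have hreal : ∀ v : Fin (N + 1) → ℝ,
      quadForm Z (Fin.tail v) - quadForm Z (Fin.init v) + windowOutput (ntfCoeff α) v ^ 2 ≤
        (γ ^ 2 - ε) * v (Fin.last N) ^ 2 := by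
    intro v
    -- The last coordinate is set to the output, the maximizer of `2 s y - s ^ 2`.
    have h1 := hM (Sum.elim (Sum.elim (Fin.init v) fun _ => v (Fin.last N))
      fun _ => windowOutput (ntfCoeff α) v)
    have h2 : ∀ M : Matrix ((Fin N ⊕ Unit) ⊕ Unit) ((Fin N ⊕ Unit) ⊕ Unit) ℝ, ∀ x,
        quadForm (-M) x = -quadForm M x := fun M x => by
      simp only [quadForm, neg_mulVec, dotProduct_neg]
    rw [h2, quadForm_boundedRealMatrix, Fin.snoc_init_self] at h1
    have h3 : |v (Fin.last N)| ≤ ‖(Sum.elim (Sum.elim (Fin.init v) fun _ => v (Fin.last N))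
        fun _ => windowOutput (ntfCoeff α) v : (Fin N ⊕ Unit) ⊕ Unit → ℝ)‖ :=
      norm_le_pi_norm (Sum.elim (Sum.elim (Fin.init v) fun _ => v (Fin.last N))
        fun _ => windowOutput (ntfCoeff α) v : (Fin N ⊕ Unit) ⊕ Unit → ℝ) (Sum.inl (Sum.inr ()))
    have h4 := mul_le_mul_of_nonneg_left (pow_le_pow_left₀ (abs_nonneg _) h3 2) hε.le
    rw [sq_abs] at h4
    linarith
  have hnonneg : ∀ x, 0 ≤ quadForm Z x := fun x => by
    simpa [quadForm] using hZ.posSemidef.dotProduct_mulVec_nonneg x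
  have hre := hreal fun i => (z ^ (i : ℕ)).re
  have him := hreal fun i => (z ^ (i : ℕ)).im
  have hshift := quadForm_re_add_quadForm_im_mul Z z fun i => z ^ (i : ℕ)
  simp only [← pow_succ'] at hshift
  have hout : windowOutput (ntfCoeff α) (fun i => (z ^ (i : ℕ)).re) ^ 2 +
      windowOutput (ntfCoeff α) (fun i => (z ^ (i : ℕ)).im) ^ 2 =
        ‖z ^ N‖ ^ 2 * ‖noiseTransferFunction α z‖ ^ 2 := by
    rw [← mul_pow, ← norm_mul, ← sum_ntfCoeff_rev_mul_pow hα hz0, Complex.sq_norm,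
      Complex.normSq_apply]
    simp [windowOutput, sq]
  have hpow : (z ^ N).re ^ 2 + (z ^ N).im ^ 2 = ‖z ^ N‖ ^ 2 := by
    rw [Complex.sq_norm, Complex.normSq_apply]
    ring
  have hq := add_nonneg (hnonneg fun i => (z ^ (i : ℕ)).re) (hnonneg fun i => (z ^ (i : ℕ)).im)
  have hz2 : 1 ≤ ‖z‖ ^ 2 := one_le_pow₀ hz.le
  have hpos : 0 < ‖z ^ N‖ ^ 2 := pow_pos (norm_pos_iff.mpr (pow_ne_zero N hz0)) 2
  simp only [Fin.tail_def, Fin.init_def, Fin.val_succ, Fin.val_castSucc, Fin.val_last] at hre him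
  have := mul_nonneg (sub_nonneg.mpr hz2) hq
  refine le_of_mul_le_mul_left ?_ hpos
  linarith [congrArg (fun r => (γ ^ 2 - ε) * r) hpow]

theorem hInfNorm_noiseTransferFunction_lt {N : ℕ} {α : Fin (N + 1) → ℝ} (hα : α 0 = 0) {γ : ℝ}
    (hγ : 0 < γ) {Z : Matrix (Fin N) (Fin N) ℝ} (hZ : Z.PosDef)
    (hM : NegDef (boundedRealMatrix α γ Z)) :
    hInfNorm (noiseTransferFunction α) < ENNReal.ofReal γ := by
  obtain ⟨ε, hε, hle⟩ := exists_mul_norm_sq_le_quadForm hM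
  calc hInfNorm (noiseTransferFunction α) ≤ ENNReal.ofReal √(γ ^ 2 - ε) := by
        refine iSup₂_le fun z hz => ?_
        rw [← ofReal_norm]
        refine ENNReal.ofReal_le_ofReal (Real.le_sqrt_of_sq_le ?_)
        exact norm_noiseTransferFunction_sq_le hα hZ hε hle hz
    _ < ENNReal.ofReal γ := by
        rw [ENNReal.ofReal_lt_ofReal_iff hγ, Real.sqrt_lt' hγ]
        linarith

/-! ### From the norm bound to the matrix inequality -/

/-- The norm only sees `|z| > 1`; the circle is reached by continuity from the points `(r z)⁻¹` as
`r` increases to `1`. -/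
theorem norm_sum_ntfCoeff_mul_pow_le {N : ℕ} {α : Fin (N + 1) → ℝ} (hα : α 0 = 0)
    (hfin : hInfNorm (noiseTransferFunction α) ≠ ∞) {z : ℂ} (hz : ‖z‖ = 1) :
    ‖∑ k : Fin (N + 1), (ntfCoeff α k : ℂ) * z ^ (k : ℕ)‖ ≤
      (hInfNorm (noiseTransferFunction α)).toReal := by
  have hcont : Continuous fun r : ℝ =>
      ‖∑ k : Fin (N + 1), (ntfCoeff α k : ℂ) * (r * z) ^ (k : ℕ)‖ := by fun_prop
  have hlim := (hcont.tendsto 1).mono_left (nhdsWithin_le_nhds (s := Set.Iio 1))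
  simp only [Complex.ofReal_one, one_mul] at hlim
  refine le_of_tendsto hlim ?_
  filter_upwards [Ioo_mem_nhdsLT (zero_lt_one' ℝ)] with r hr
  have hout : 1 < ‖((r : ℂ) * z)⁻¹‖ := by
    rw [norm_inv, norm_mul, hz, mul_one, Complex.norm_real, Real.norm_of_nonneg hr.1.le]
    exact (one_lt_inv₀ hr.1).mpr hr.2
  have h := le_iSup₂ (f := fun (w : ℂ) (_ : 1 < ‖w‖) => ‖noiseTransferFunction α w‖ₑ) _ hout
  have h' := ENNReal.toReal_mono hfin h
  rwa [toReal_enorm, noiseTransferFunction_eq hα, inv_inv] at h'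

theorem exists_negDef_boundedRealMatrix {N : ℕ} {α : Fin (N + 1) → ℝ} (hα : α 0 = 0) {γ : ℝ}
    (hlt : hInfNorm (noiseTransferFunction α) < ENNReal.ofReal γ) :
    ∃ Z : Matrix (Fin N) (Fin N) ℝ,
      Z.IsSymm ∧ Z.PosDef ∧ NegDef (boundedRealMatrix α γ Z) := by
  have hfin := hlt.ne_top
  set g := (hInfNorm (noiseTransferFunction α)).toReal with hg
  have hgγ : g < γ := (ENNReal.lt_ofReal_iff_toReal_lt hfin).mp hlt
  have hg0 : 0 ≤ g := ENNReal.toReal_nonneg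
  have hN : (0 : ℝ) < N + 1 := by positivity
  have hgap : 0 < γ ^ 2 - g ^ 2 := by nlinarith
  -- The margin spends half of the gap `γ ^ 2 - g ^ 2` on the `N + 1` overlapping windows.
  set ε := (γ ^ 2 - g ^ 2) / (2 * (N + 1)) with hε
  have hε0 : 0 < ε := by positivity
  have hεN : ε * (N + 1) = (γ ^ 2 - g ^ 2) / 2 := by
    rw [hε]
    field_simp
  obtain ⟨Z, hZ, hpos, hdiss⟩ := exists_quadForm_dissipation (ntfCoeff α) (γ := γ) hε0
    (fun z hz => norm_sum_ntfCoeff_mul_pow_le hα hfin hz) (by linarith)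
  refine ⟨Z, hZ, PosDef.of_dotProduct_mulVec_pos (isHermitian_iff_isSymm.mpr hZ)
    (fun x hx => by simpa [quadForm] using hpos x hx),
    PosDef.of_dotProduct_mulVec_pos
      (isHermitian_iff_isSymm.mpr (isSymm_boundedRealMatrix α γ hZ).neg) fun y hy => ?_⟩
  rw [star_trivial, neg_mulVec, dotProduct_neg]
  change 0 < -quadForm _ y
  obtain ⟨x, u, s, rfl⟩ : ∃ (x : Fin N → ℝ) (u s : ℝ),
      y = Sum.elim (Sum.elim x fun _ => u) fun _ => s :=
    ⟨fun i => y (.inl (.inl i)), y (.inl (.inr ())), y (.inr ()), by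
      ext ((i | i) | i) <;> rfl⟩
  rw [quadForm_boundedRealMatrix]
  set v : Fin (N + 1) → ℝ := Fin.snoc x u with hv
  have h1 := hdiss v
  rw [stageCost, hv, Fin.init_snoc, Fin.snoc_last, ← hv] at h1
  have hvv : 0 ≤ v ⬝ᵥ v := Finset.sum_nonneg fun i _ => mul_self_nonneg (v i)
  -- Strictness comes from the `ε` margin when the window is nonzero, and from `-s ^ 2` when it
  -- vanishes.
  rcases hvv.lt_or_eq with h | h
  · nlinarith [sq_nonneg (s - windowOutput (ntfCoeff α) v), mul_pos hε0 h]
  · have hv0 : v = 0 := dotProduct_self_eq_zero.mp h.symm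
    have hs : s ≠ 0 := by
      rintro rfl
      refine hy ?_
      have hx : ∀ i, x i = 0 := fun i => by
        have := congrFun hv0 i.castSucc
        rwa [hv, Fin.snoc_castSucc] at this
      have hu : u = 0 := by
        have := congrFun hv0 (Fin.last N)
        rwa [hv, Fin.snoc_last] at this
      ext ((i | i) | i) <;> simp [hx, hu]
    have hw : windowOutput (ntfCoeff α) v = 0 := by simp [hv0, windowOutput]
    rw [hw] at h1 ⊢
    nlinarith [sq_pos_of_ne_zero hs]

theorem lemma2 (N : ℕ) (α : Fin (N + 1) → ℝ) (hα : α 0 = 0) (γ₀ : ℝ) (hγ₀ : 0 < γ₀) :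
    hInfNorm (noiseTransferFunction α) < ENNReal.ofReal γ₀ ↔
      ∃ Z : Matrix (Fin N) (Fin N) ℝ,
        Z.IsSymm ∧ Z.PosDef ∧ NegDef (boundedRealMatrix α γ₀ Z) :=
  ⟨exists_negDef_boundedRealMatrix hα, fun ⟨_, _, hZ, hM⟩ =>
    hInfNorm_noiseTransferFunction_lt hα hγ₀ hZ hM⟩
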